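/- Let $M$ be a compact connected smooth Riemannian manifold (without boundary) with its Riemannian distance $d$, let $p\ge 1$, and let $g_1,\dots,g_p:M\to M$ be $C^2$ expanding maps, i.e. each $g_i$ is $C^2$ and there is $\lambda_i>1$ with $\|D_xg_i(v)\|\ge\lambda_i\|v\|$ for all $x\in M$, $v\in T_xM$. Let $S$ be the action on $M$ of the semigroup generated by $\{\mathrm{id},g_1,\dots,g_p\}$. For $\omega=\omega_1\omega_2\dots\in\Sigma_p^+=\{1,\dots,p\}^{\mathbb N}$, $n\ge 1$ and $\varepsilon>0$ let $s(g_{\omega_n}\cdots g_{\omega_1},n,\varepsilon)$ be the maximal cardinality of a set $K\subset M$ such that $\max_{0\le j\le n}d(g_{\omega_j}\cdots g_{\omega_1}x,\;g_{\omega_j}\cdots g_{\omega_1}y)>\varepsilon$ for all distinct $x,y\in K$ (the empty composition, $j=0$, being the identity). For a Borel probability measure $\eta$ on $\Sigma_p^+$, the relative topological entropy of $S$ with respect to $\eta$ is $$h_{\rm top}(S,\eta)=\lim_{\varepsilon\to0}\limsup_{n\to\infty}\frac1n\log\int_{\Sigma_p^+}s(g_{\omega_n}\cdots g_{\omega_1},n,\varepsilon)\,d\eta(\omega).$$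 Let $\mathcal M_B(\Sigma_p^+)$ be the set of Bernoulli measures $\eta_{\underline a}=\underline a^{\mathbb N}$, where $\underline a=(a_1,\dots,a_p)$ is a probability vector (some entries may be zero), with the weak$^*$ topology, and let $\eta_{\underline p}$ be the symmetric one, $\underline a=(1/p,\dots,1/p)$. Then for each $i$ the number $\deg(g_i)=\#\,g_i^{-1}(\{x\})$ is finite and does not depend on $x\in M$, and: 1. the map $\eta\mapsto h_{\rm top}(S,\eta)$ is continuous on $\mathcal M_B(\Sigma_p^+)$; 2. there exists $\eta_0\in\mathcal M_B(\Sigma_p^+)$ such that $\sup_{\eta\in\mathcal M_B(\Sigma_p^+)}h_{\rm top}(S,\eta)=h_{\rm top}(S,\eta_0)$; 3. $\sup_{\eta\in\mathcal M_B(\Sigma_p^+)}h_{\rm top}(S,\eta)=\log\big(\max_{1\le i\le p}\deg(g_i)\big)$; 4. $\sup_{\eta\in\mathcal M_B(\Sigma_p^+)}h_{\rm top}(S,\eta)=h_{\rm top}(S,\eta_{\underline p})$ if and only if all the degrees $\deg(g_i)$, $1\le i\le p$, are equal. -/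

import Mathlib

open Set Filter Topology MeasureTheory Bundle
open scoped Manifold ContDiff ENNReal

noncomputable section

/-- `walk g w n` is the concatenation `g_{ω_n} ∘ ⋯ ∘ g_{ω_1}` of the first `n` letters of the
sequence `ω = w`, where `ω_1, ω_2, …` are stored as `w 0, w 1, …`; `walk g w 0` is the identity. -/
def walk {M : Type*} {p : ℕ} (g : Fin p → M → M) (w : ℕ → Fin p) : ℕ → M → M
  | 0 => id
  | n + 1 => g (w n) ∘ walk g w n

/-- The dynamical metric `max_{0 ≤ j ≤ n} d (g_{ω_j} ⋯ g_{ω_1} x, g_{ω_j} ⋯ g_{ω_1} y)`. -/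
def dynDist {M : Type*} [MetricSpace M] {p : ℕ} (g : Fin p → M → M) (w : ℕ → Fin p) (n : ℕ)
    (x y : M) : ℝ :=
  (Finset.range (n + 1)).sup' Finset.nonempty_range_add_one
    fun j => dist (walk g w j x) (walk g w j y)

/-- `K` is separated at scale `ε` along the word `g_{ω_n} ⋯ g_{ω_1}`. -/
def IsDynSeparated {M : Type*} [MetricSpace M] {p : ℕ} (g : Fin p → M → M) (w : ℕ → Fin p)
    (n : ℕ) (ε : ℝ) (K : Set M) : Prop :=
  ∀ x ∈ K, ∀ y ∈ K, x ≠ y → ε < dynDist g w n x y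

/-- The maximal cardinality `s (g_{ω_n} ⋯ g_{ω_1}, n, ε)` of a separated set. -/
def sepCard {M : Type*} [MetricSpace M] {p : ℕ} (g : Fin p → M → M) (w : ℕ → Fin p)
    (n : ℕ) (ε : ℝ) : ℕ∞ :=
  ⨆ K ∈ {K : Set M | IsDynSeparated g w n ε K}, K.encard

/-- `limsup_n (1/n) log ∫ s (g_{ω_n} ⋯ g_{ω_1}, n, ε) dη(ω)`. -/
def relEntropyAt {M : Type*} [MetricSpace M] {p : ℕ} (g : Fin p → M → M)
    (η : Measure (ℕ → Fin p)) (ε : ℝ) : EReal :=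
  limsup (fun n : ℕ => ENNReal.log (∫⁻ w, (sepCard g w n ε : ℝ≥0∞) ∂η) / (n : EReal)) atTop

/-- The relative topological entropy `h_top(S, η)` of the semigroup action generated by the maps
`g i`: the limit of `relEntropyAt g η ε` as `ε → 0⁺`. As `relEntropyAt g η ε` is antitone in `ε`,
this limit is the supremum over `ε > 0` (see `tendsto_relEntropyAt`). -/
def relEntropy {M : Type*} [MetricSpace M] {p : ℕ} (g : Fin p → M → M)
    (η : Measure (ℕ → Fin p)) : EReal :=
  ⨆ ε ∈ Ioi (0 : ℝ), relEntropyAt g η ε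

theorem antitone_relEntropyAt {M : Type*} [MetricSpace M] {p : ℕ} (g : Fin p → M → M)
    (η : Measure (ℕ → Fin p)) : Antitone (relEntropyAt g η) := by
  intro ε ε' h
  refine limsup_le_limsup (Eventually.of_forall fun n => ?_) (by isBoundedDefault)
    (by isBoundedDefault)
  refine EReal.div_le_div_right_of_nonneg (by positivity) (ENNReal.log_le_log ?_)
  refine lintegral_mono fun w => ?_
  refine ENat.toENNReal_le.2 (biSup_mono fun K hK x hx y hy hxy => ?_)
  exact h.trans_lt (hK x hx y hy hxy)

/-- The relative topological entropy is indeed the limit as `ε → 0⁺`. -/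
theorem tendsto_relEntropyAt {M : Type*} [MetricSpace M] {p : ℕ} (g : Fin p → M → M)
    (η : Measure (ℕ → Fin p)) :
    Tendsto (relEntropyAt g η) (𝓝[>] 0) (𝓝 (relEntropy g η)) := by
  have h := (antitone_relEntropyAt g η).tendsto_nhdsGT 0
  rwa [sSup_image] at h

/-- The probability measure on `{1, …, p}` with weights `a`. -/
def letterMeasure {p : ℕ} (a : stdSimplex ℝ (Fin p)) : Measure (Fin p) :=
  ∑ i, ENNReal.ofReal (a.1 i) • Measure.dirac i

instance {p : ℕ} (a : stdSimplex ℝ (Fin p)) : IsProbabilityMeasure (letterMeasure a) := by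
  refine ⟨?_⟩
  simp only [letterMeasure, Measure.coe_finsetSum, Finset.sum_apply, Measure.smul_apply,
    measure_univ, smul_eq_mul, mul_one]
  rw [← ENNReal.ofReal_sum_of_nonneg fun i _ => a.2.1 i, a.2.2, ENNReal.ofReal_one]

/-- The Bernoulli measure `η_a = a^ℕ` on the full one-sided shift space, for a probability
vector `a` (entries may vanish). -/
def bernoulliMeasure {p : ℕ} (a : stdSimplex ℝ (Fin p)) : ProbabilityMeasure (ℕ → Fin p) :=
  ⟨Measure.infinitePi fun _ : ℕ => letterMeasure a, inferInstance⟩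

/-- The space of Bernoulli measures on the full one-sided shift space on `p` symbols, as a
subset of the space of Borel probability measures with the weak topology. -/
def bernoulliMeasures (p : ℕ) : Set (ProbabilityMeasure (ℕ → Fin p)) :=
  range bernoulliMeasure

/-- The symmetric random walk: the Bernoulli measure of the vector `(1/p, …, 1/p)`. -/
def symmetricBernoulli (p : ℕ) [NeZero p] : ProbabilityMeasure (ℕ → Fin p) :=
  bernoulliMeasure stdSimplex.barycenter

/-- `T` is a `C²` expanding map of the Riemannian manifold `M`: it is `C²` and, for some `c > 1`,
`‖D_x T v‖ ≥ c ‖v‖` for all tangent vectors `v`. The norms are those of the Riemannian metric. -/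
structure IsC2Expanding {d : ℕ} {M : Type*} [MetricSpace M]
    [ChartedSpace (EuclideanSpace ℝ (Fin d)) M] [IsManifold (𝓡 d) ∞ M]
    [RiemannianBundle (fun x : M => TangentSpace (𝓡 d) x)] (T : M → M) : Prop where
  contMDiff : ContMDiff (𝓡 d) (𝓡 d) 2 T
  expanding : ∃ c : ℝ, 1 < c ∧ ∀ (x : M) (v : TangentSpace (𝓡 d) x),
    c * ‖v‖ ≤ ‖mfderiv (𝓡 d) (𝓡 d) T x v‖

/-- The degree of a map, that is, the number of preimages of a point. (For the expanding maps
considered here all points have the same finite number of preimages.) -/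
def mapDegree {M : Type*} [Nonempty M] (T : M → M) : ℕ :=
  (T ⁻¹' {Classical.arbitrary M}).ncard

end

/-! Everything follows from the formula: the entropy of `η_a` is `log ∑ a_i deg g_i`. An expanding
map is a local homeomorphism of a compact connected space, hence a finite covering of constant
degree, and its inverse branches do not increase distances
(`IsC2Expanding.exists_preimage_dist_lt`).

For a word of length `n`, let `P` be the product of the degrees of its letters. For some small `ε`,
each fibre of the word is an `ε`-separated set with `P` points (`exists_prod_le_sepCard`). For any
`ε`, every orbit is shadowed by one ending in a fixed finite `ε/2`-net, so separated sets have at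
most `N * P` points, with `N` independent of the word (`exists_sepCard_le_mul_prod`). By
independence of the letters, `P` has integral `(∑ a_i deg g_i)^n`, and the factor `N` disappears in
the growth rate.

The mean degree is affine in `a`: it is maximal at a vertex, and the barycenter attains the maximum
only if all degrees agree. -/

/-- Inverse function theorem on a manifold: a `C¹` map whose derivative at `x` is injective
restricts to a partial homeomorphism near `x` with a `C¹` inverse. -/
theorem exists_openPartialHomeomorph_of_injective_mfderiv {d : ℕ} {M : Type*} [TopologicalSpace M]
    [ChartedSpace (EuclideanSpace ℝ (Fin d)) M] [IsManifold (𝓡 d) 1 M] {T : M → M}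
    (hT : ContMDiff (𝓡 d) (𝓡 d) 1 T) (x : M)
    (hinj : Function.Injective (mfderiv (𝓡 d) (𝓡 d) T x)) :
    ∃ e : OpenPartialHomeomorph M M, x ∈ e.source ∧ EqOn T e e.source ∧
      ContMDiffAt (𝓡 d) (𝓡 d) 1 e.symm (T x) := by
  set φ := chartAt (EuclideanSpace ℝ (Fin d)) x with hφ
  set ψ := chartAt (EuclideanSpace ℝ (Fin d)) (T x) with hψ
  set F : EuclideanSpace ℝ (Fin d) → EuclideanSpace ℝ (Fin d) := ψ ∘ T ∘ φ.symm with hF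
  have hFs : ContDiffAt ℝ 1 F (φ x) := by
    have h := (contMDiffAt_iff.1 (hT x)).2
    simpa [mfld_simps, contDiffWithinAt_univ] using h
  have hder : mfderiv (𝓡 d) (𝓡 d) T x = fderiv ℝ F (φ x) := by
    refine ((hT x).mdifferentiableAt one_ne_zero).mfderiv.trans ?_
    simp [mfld_simps, fderivWithin_univ, writtenInExtChartAt, hF, hφ, hψ]
    rfl
  have hinj' : Function.Injective (fderiv ℝ F (φ x)) := by
    intro v w hvw
    refine hinj ?_
    rw [hder]
    exact hvw
  -- In finite dimension an injective endomorphism is invertible.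
  let A : EuclideanSpace ℝ (Fin d) ≃L[ℝ] EuclideanSpace ℝ (Fin d) :=
    (LinearEquiv.ofInjectiveEndo (fderiv ℝ F (φ x)).toLinearMap hinj').toContinuousLinearEquiv
  have hA : HasFDerivAt F (A : EuclideanSpace ℝ (Fin d) →L[ℝ] EuclideanSpace ℝ (Fin d)) (φ x) :=
    (hFs.differentiableAt one_ne_zero).hasFDerivAt
  let G := hFs.toOpenPartialHomeomorph F hA one_ne_zero
  have hGx : φ x ∈ G.source := hFs.mem_toOpenPartialHomeomorph_source hA one_ne_zero
  have hGs : ContDiffAt ℝ 1 G.symm (F (φ x)) := hFs.to_localInverse hA one_ne_zero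
  have hxφ : x ∈ φ.source := mem_chart_source _ x
  have hxψ : T x ∈ ψ.source := mem_chart_source _ (T x)
  have hFx : F (φ x) = ψ (T x) := by simp [hF, φ.left_inv hxφ]
  have hG : ∀ z, G z = F z := fun _ => rfl
  -- Restricting to points that `T` sends into the chart `ψ` ensures that `ψ.symm ∘ ψ ∘ T` is `T`
  -- there.
  let e := ((φ.trans G).trans ψ.symm).restrOpen (T ⁻¹' ψ.source)
    (ψ.open_source.preimage hT.continuous)
  refine ⟨e, ?_, ?_, ?_⟩
  · simp [e, hxφ, hGx, hxψ, hG, hFx, ψ.map_source hxψ]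
  · intro z hz
    simp only [e, OpenPartialHomeomorph.restrOpen_source, OpenPartialHomeomorph.trans_source,
      mem_inter_iff, mem_preimage] at hz
    have h1 : F (φ z) = ψ (T z) := by simp [hF, φ.left_inv hz.1.1.1]
    change T z = ψ.symm (F (φ z))
    rw [h1, ψ.left_inv hz.2]
  · change ContMDiffAt (𝓡 d) (𝓡 d) 1 (φ.symm ∘ G.symm ∘ ψ) (T x)
    have hGy : G.symm (ψ (T x)) = φ x := by
      rw [← hFx]; exact G.left_inv hGx
    refine ContMDiffAt.comp (I' := 𝓡 d) _ ?_ (ContMDiffAt.comp (I' := 𝓡 d) _ ?_ ?_)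
    · simp only [Function.comp_apply]
      rw [hGy]
      exact contMDiffOn_chart_symm.contMDiffAt (φ.open_target.mem_nhds (φ.map_source hxφ))
    · rw [contMDiffAt_iff_contDiffAt, ← hFx]
      exact hGs
    · exact contMDiffOn_chart.contMDiffAt (ψ.open_source.mem_nhds hxψ)

/-! ### Expanding maps: lifting curves and contracting inverse branches -/

namespace IsC2Expanding

variable {d : ℕ} {M : Type*} [MetricSpace M]
  [ChartedSpace (EuclideanSpace ℝ (Fin d)) M] [IsManifold (𝓡 d) ∞ M]
  [RiemannianBundle (fun x : M => TangentSpace (𝓡 d) x)] {T : M → M}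

theorem norm_le (hT : IsC2Expanding (d := d) T) (x : M) (v : TangentSpace (𝓡 d) x) :
    ‖v‖ ≤ ‖mfderiv (𝓡 d) (𝓡 d) T x v‖ := by
  obtain ⟨c, hc, h⟩ := hT.expanding
  exact (le_mul_of_one_le_left (norm_nonneg v) hc.le).trans (h x v)

theorem injective_mfderiv (hT : IsC2Expanding (d := d) T) (x : M) :
    Function.Injective (mfderiv (𝓡 d) (𝓡 d) T x) := by
  refine (injective_iff_map_eq_zero _).2 fun v hv => ?_
  have h := hT.norm_le x v
  rw [hv, norm_zero] at h
  exact norm_le_zero_iff.1 h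

theorem exists_openPartialHomeomorph (hT : IsC2Expanding (d := d) T) (x : M) :
    ∃ e : OpenPartialHomeomorph M M, x ∈ e.source ∧ EqOn T e e.source ∧
      ContMDiffAt (𝓡 d) (𝓡 d) 1 e.symm (T x) :=
  have : IsManifold (𝓡 d) 1 M := .of_le (n := ∞) (by simp)
  exists_openPartialHomeomorph_of_injective_mfderiv (hT.contMDiff.of_le (by norm_num)) x
    (hT.injective_mfderiv x)

theorem isLocalHomeomorph (hT : IsC2Expanding (d := d) T) : IsLocalHomeomorph T :=
  IsLocalHomeomorph.mk T fun x =>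
    let ⟨e, hx, he, _⟩ := hT.exists_openPartialHomeomorph x
    ⟨e, hx, he⟩

/-- Continuous lifts of `C¹` curves through an expanding map are `C¹`. -/
theorem contMDiff_lift (hT : IsC2Expanding (d := d) T) {γ Γ : ℝ → M}
    (hγ : ContMDiff 𝓘(ℝ, ℝ) (𝓡 d) 1 γ) (hΓ : Continuous Γ) (h : T ∘ Γ = γ) :
    ContMDiff 𝓘(ℝ, ℝ) (𝓡 d) 1 Γ := by
  intro t
  obtain ⟨e, ht, he, hs⟩ := hT.exists_openPartialHomeomorph (Γ t)
  have hγt : T (Γ t) = γ t := congrFun h t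
  rw [hγt] at hs
  -- By continuity `Γ` stays in the domain of one branch near `t`, so there it is `e.symm ∘ γ`.
  refine (hs.comp t (hγ t)).congr_of_eventuallyEq ?_
  filter_upwards [hΓ.continuousAt (e.open_source.mem_nhds ht)] with s hs
  rw [Function.comp_apply, ← h, Function.comp_apply, he hs, e.left_inv hs]

/-- By the chain rule the speed of `γ` is `‖DT Γ'‖`, which is at least `‖Γ'‖`. -/
theorem pathELength_lift_le (hT : IsC2Expanding (d := d) T) {γ Γ : ℝ → M}
    (hΓ : ContMDiff 𝓘(ℝ, ℝ) (𝓡 d) 1 Γ) (h : T ∘ Γ = γ) (a b : ℝ) :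
    Manifold.pathELength (𝓡 d) Γ a b ≤ Manifold.pathELength (𝓡 d) γ a b := by
  subst h
  rw [Manifold.pathELength_eq_lintegral_mfderiv_Icc, Manifold.pathELength_eq_lintegral_mfderiv_Icc]
  refine lintegral_mono fun t => ?_
  rw [mfderiv_comp t ((hT.contMDiff _).mdifferentiableAt two_ne_zero)
    ((hΓ t).mdifferentiableAt one_ne_zero)]
  exact enorm_le_iff_norm_le.2 (hT.norm_le (Γ t) _)

/-- Inverse branches of an expanding map do not increase distances. -/
theorem exists_preimage_dist_lt [CompactSpace M] [IsRiemannianManifold (𝓡 d) M]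
    (hT : IsC2Expanding (d := d) T) {y z : M} {r : ℝ} (hr : dist (T y) z < r) :
    ∃ y', T y' = z ∧ dist y y' < r := by
  have hcov : IsCoveringMap T := isLocalHomeomorph_iff_isCoveringMap.1 hT.isLocalHomeomorph
  have hr0 : 0 < r := dist_nonneg.trans_lt hr
  have hlt : Manifold.riemannianEDist (𝓡 d) (T y) z < ENNReal.ofReal r := by
    rw [← IsRiemannianManifold.out, edist_dist]
    exact (ENNReal.ofReal_lt_ofReal_iff hr0).2 hr
  -- A `C¹` curve of length `< r` from `T y` to `z`, defined on all of `ℝ`; the endpoint of its lift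
  -- from `y` is the required preimage.
  obtain ⟨γ, h0, h1, hγ, hlen, -, -⟩ :=
    Manifold.exists_lt_locally_constant_of_riemannianEDist_lt hlt zero_lt_one
  obtain ⟨Γ, ⟨hΓ0, hΓ⟩, -⟩ := hcov.existsUnique_continuousMap_lifts ⟨γ, hγ.continuous⟩ 0 y h0.symm
  replace hΓ : T ∘ Γ = γ := hΓ
  have hΓs := hT.contMDiff_lift hγ Γ.continuous hΓ
  refine ⟨Γ 1, (congrFun hΓ 1).trans h1, ?_⟩
  have h2 : edist y (Γ 1) < ENNReal.ofReal r := by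
    rw [IsRiemannianManifold.out (I := 𝓡 d)]
    exact (Manifold.riemannianEDist_le_pathELength hΓs.contMDiffOn hΓ0 rfl zero_le_one).trans_lt
      ((hT.pathELength_lift_le hΓs hΓ 0 1).trans_lt hlen)
  rwa [edist_dist, ENNReal.ofReal_lt_ofReal_iff hr0] at h2

end IsC2Expanding

/-! ### Cardinality of fibres -/

section Fibers

variable {M : Type*}

/-- A trivialization around `x` identifies all nearby fibres with the one over `x`, so the
cardinality is locally constant. -/
theorem IsCoveringMap.encard_fiber_eq {E X : Type*} [TopologicalSpace E] [TopologicalSpace X]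
    [PreconnectedSpace X] {f : E → X} (hf : IsCoveringMap f) (x y : X) :
    (f ⁻¹' {x}).encard = (f ⁻¹' {y}).encard := by
  have h : IsLocallyConstant fun x => (f ⁻¹' {x}).encard := by
    refine (IsLocallyConstant.iff_exists_open _).2 fun x => ?_
    obtain ⟨hd, U, hxU, hU, hfU, H, hH⟩ := hf x
    refine ⟨U, hU, hxU, fun y hy => ?_⟩
    have h1 : IsEvenlyCovered f y (f ⁻¹' {x}) := ⟨hd, U, hy, hU, hfU, H, hH⟩
    exact Set.encard_congr h1.fiberHomeomorph.symm.toEquiv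
  exact h.apply_eq_of_preconnectedSpace x y

theorem IsLocalHomeomorph.finite_fiber [TopologicalSpace M] [T2Space M] [CompactSpace M]
    {f : M → M} (hf : IsLocalHomeomorph f) (x : M) : (f ⁻¹' {x}).Finite := by
  have h := (isLocalHomeomorph_iff_isCoveringMap.1 hf x).discreteTopology_fiber
  exact (isClosed_singleton.preimage hf.continuous).isCompact.finite ⟨h⟩

theorem IsLocalHomeomorph.encard_fiber [TopologicalSpace M] [T2Space M] [CompactSpace M]
    [ConnectedSpace M] {f : M → M} (hf : IsLocalHomeomorph f) (x : M) :
    (f ⁻¹' {x}).encard = mapDegree f := by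
  rw [(isLocalHomeomorph_iff_isCoveringMap.1 hf).encard_fiber_eq x (Classical.arbitrary M),
    mapDegree, (hf.finite_fiber _).cast_ncard_eq]

/-- The image is compact and open, hence everything. -/
theorem IsLocalHomeomorph.mapDegree_pos [TopologicalSpace M] [T2Space M] [CompactSpace M]
    [ConnectedSpace M] {f : M → M} (hf : IsLocalHomeomorph f) : 0 < mapDegree f := by
  have h : range f = univ := IsClopen.eq_univ
    ⟨(isCompact_range hf.continuous).isClosed, hf.isOpenMap.isOpen_range⟩ (range_nonempty f)
  obtain ⟨y, hy⟩ := range_eq_univ.1 h (Classical.arbitrary M)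
  exact (ncard_pos (hf.finite_fiber _)).2 ⟨y, hy⟩

theorem Set.encard_preimage_of_encard_fiber {α β : Type*} {f : α → β} {k : ℕ∞}
    (h : ∀ z, (f ⁻¹' {z}).encard = k) {s : Set β} (hs : s.Finite) :
    (f ⁻¹' s).encard = k * s.encard := by
  induction s, hs using Set.Finite.induction_on with
  | empty => simp
  | @insert a s ha _ ih =>
    rw [insert_eq, preimage_union, encard_union_eq, h, ih, encard_union_eq, encard_singleton,
      mul_add, mul_one]
    · exact disjoint_singleton_left.2 ha
    · exact (disjoint_singleton_left.2 ha).preimage f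

theorem encard_walk_preimage {p : ℕ} {g : Fin p → M → M}
    (hfin : ∀ i x, (g i ⁻¹' {x}).Finite) {D : Fin p → ℕ∞}
    (hD : ∀ i x, (g i ⁻¹' {x}).encard = D i) (w : ℕ → Fin p) (n : ℕ) (x : M) :
    (walk g w n ⁻¹' {x}).encard = ∏ j ∈ Finset.range n, D (w j) := by
  induction n generalizing x with
  | zero => simp [walk]
  | succ n ih =>
    rw [walk, preimage_comp, encard_preimage_of_encard_fiber ih (hfin _ _), hD,
      Finset.prod_range_succ]

end Fibers

/-! ### Bounds for separated sets -/

section Separation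

variable {M : Type*} [MetricSpace M] {p : ℕ} {g : Fin p → M → M}

theorem dist_walk_le_dynDist (w : ℕ → Fin p) {j n : ℕ} (h : j ≤ n) (x y : M) :
    dist (walk g w j x) (walk g w j y) ≤ dynDist g w n x y :=
  Finset.le_sup' (fun j => dist (walk g w j x) (walk g w j y)) (by simpa [Nat.lt_succ_iff] using h)

/-- If each generator separates the points of its fibres at scale `ε`, so does each word. -/
theorem lt_dynDist_of_walk_eq {ε : ℝ} (hε : ∀ i x y, g i x = g i y → x ≠ y → ε < dist x y)
    (w : ℕ → Fin p) (n : ℕ) {x y : M} (h : walk g w n x = walk g w n y) (hxy : x ≠ y) :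
    ε < dynDist g w n x y := by
  -- Take `j` to be the last time at which the orbits differ: the next letter identifies them, so
  -- they lie in one of its fibres.
  obtain ⟨j, hj, hlt⟩ : ∃ j ≤ n, ε < dist (walk g w j x) (walk g w j y) := by
    induction n with
    | zero => exact absurd h hxy
    | succ n ih =>
      by_cases hn : walk g w n x = walk g w n y
      · obtain ⟨j, hj, hlt⟩ := ih hn
        exact ⟨j, hj.trans n.le_succ, hlt⟩
      · exact ⟨n, n.le_succ, hε _ _ _ h hn⟩
  exact hlt.trans_le (dist_walk_le_dynDist w hj x y)

/-- Points close to the end of an orbit are ends of orbits close to the given one. -/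
theorem exists_walk_eq_of_dist_lt {r : ℝ}
    (hg : ∀ i y z, dist (g i y) z < r → ∃ y', g i y' = z ∧ dist y y' < r)
    (w : ℕ → Fin p) (n : ℕ) {y z : M} (h : dist (walk g w n y) z < r) :
    ∃ y', walk g w n y' = z ∧ ∀ j ≤ n, dist (walk g w j y) (walk g w j y') < r := by
  induction n generalizing z with
  | zero => exact ⟨z, rfl, fun j hj => by rwa [Nat.le_zero.1 hj]⟩
  | succ n ih =>
    -- Pull back through the last letter; the radius `r` is preserved, so the induction continues.
    obtain ⟨z', hz', hd⟩ := hg (w n) (walk g w n y) z h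
    obtain ⟨y', hy', hj⟩ := ih hd
    have hw : walk g w (n + 1) y' = z := by rw [walk, Function.comp_apply, hy', hz']
    refine ⟨y', hw, fun j hjn => ?_⟩
    rcases hjn.lt_or_eq with hlt | rfl
    · exact hj j (Nat.lt_succ_iff.1 hlt)
    · rwa [hw]

/-- `δ` is a Lebesgue number of a cover by open sets on which `f` is injective. -/
theorem IsLocalHomeomorph.exists_fiber_separated [CompactSpace M] {f : M → M}
    (hf : IsLocalHomeomorph f) : ∃ δ > 0, ∀ x y, f x = f y → x ≠ y → δ ≤ dist x y := by
  choose e he hfe using hf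
  obtain ⟨δ, hδ, h⟩ := lebesgue_number_lemma_of_metric (isCompact_univ (X := M))
    (c := fun x => (e x).source) (fun x => (e x).open_source)
    (fun x _ => mem_iUnion.2 ⟨x, he x⟩)
  refine ⟨δ, hδ, fun x y hxy hne => ?_⟩
  by_contra! hlt
  obtain ⟨i, hi⟩ := h x (mem_univ x)
  refine hne ((e i).injOn (hi (Metric.mem_ball_self hδ)) (hi (Metric.mem_ball'.2 hlt)) ?_)
  rwa [← hfe i]

theorem exists_forall_fiber_separated [CompactSpace M] (hg : ∀ i, IsLocalHomeomorph (g i)) :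
    ∃ ε > 0, ∀ i x y, g i x = g i y → x ≠ y → ε < dist x y := by
  have h : ∀ᶠ ε in 𝓝[>] (0 : ℝ), ∀ i x y, g i x = g i y → x ≠ y → ε < dist x y := by
    refine eventually_all.2 fun i => ?_
    obtain ⟨δ, hδ, h⟩ := (hg i).exists_fiber_separated
    filter_upwards [Ioo_mem_nhdsGT hδ] with ε hε x y hxy hne
    exact hε.2.trans_le (h x y hxy hne)
  obtain ⟨ε, hε, hpos⟩ := (h.and self_mem_nhdsWithin).exists
  exact ⟨ε, hpos, hε⟩

theorem exists_prod_le_sepCard [CompactSpace M] [ConnectedSpace M]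
    (hg : ∀ i, IsLocalHomeomorph (g i)) :
    ∃ ε > 0, ∀ (w : ℕ → Fin p) (n : ℕ),
      ((∏ j ∈ Finset.range n, mapDegree (g (w j)) : ℕ) : ℕ∞) ≤ sepCard g w n ε := by
  obtain ⟨ε, hε, h⟩ := exists_forall_fiber_separated hg
  refine ⟨ε, hε, fun w n => ?_⟩
  have hsep : IsDynSeparated g w n ε (walk g w n ⁻¹' {Classical.arbitrary M}) :=
    fun x hx y hy hxy => lt_dynDist_of_walk_eq h w n (hx.trans hy.symm) hxy
  rw [Nat.cast_prod, ← encard_walk_preimage (fun i => (hg i).finite_fiber)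
    (fun i => (hg i).encard_fiber) w n (Classical.arbitrary M)]
  exact le_iSup₂ (f := fun (K : Set M) (_ : K ∈ {K : Set M | IsDynSeparated g w n ε K}) =>
    K.encard) _ hsep

theorem exists_sepCard_le_mul_prod [CompactSpace M] [ConnectedSpace M]
    (hg : ∀ i, IsLocalHomeomorph (g i))
    (hlift : ∀ i y z r, dist (g i y) z < r → ∃ y', g i y' = z ∧ dist y y' < r)
    {ε : ℝ} (hε : 0 < ε) :
    ∃ N : ℕ, ∀ (w : ℕ → Fin p) (n : ℕ),
      sepCard g w n ε ≤ ((N * ∏ j ∈ Finset.range n, mapDegree (g (w j)) : ℕ) : ℕ∞) := by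
  obtain ⟨t, -, htf, ht⟩ := finite_cover_balls_of_compact (isCompact_univ (X := M))
    (half_pos hε)
  refine ⟨t.ncard, fun w n => iSup₂_le fun K hK => ?_⟩
  have hex : ∀ y : M, ∃ y', walk g w n y' ∈ t ∧
      ∀ j ≤ n, dist (walk g w j y) (walk g w j y') < ε / 2 := by
    intro y
    obtain ⟨z, hz, hd⟩ := mem_iUnion₂.1 (ht (mem_univ (walk g w n y)))
    obtain ⟨y', hy', h⟩ := exists_walk_eq_of_dist_lt (fun i y z => hlift i y z _) w n hd
    exact ⟨y', hy' ▸ hz, h⟩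
  choose F hFt hF using hex
  -- Points with the same shadow stay within `ε/2 + ε/2` of each other up to time `n`, so they are
  -- not separated.
  have hinj : InjOn F K := by
    intro x hx y hy hxy
    by_contra hne
    refine (hK x hx y hy hne).not_ge (Finset.sup'_le _ _ fun j hj => ?_)
    have hj' : j ≤ n := Nat.lt_succ_iff.1 (Finset.mem_range.1 hj)
    have h1 := hF x j hj'
    have h2 := hF y j hj'
    rw [← hxy] at h2
    have h3 := dist_triangle_right (walk g w j x) (walk g w j y) (walk g w j (F x))
    linarith
  calc K.encard ≤ (walk g w n ⁻¹' t).encard :=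
        encard_le_encard_of_injOn (fun y _ => hFt y) hinj
    _ = _ := by
        rw [encard_preimage_of_encard_fiber (encard_walk_preimage (fun i => (hg i).finite_fiber)
          (fun i => (hg i).encard_fiber) w n) htf, ← htf.cast_ncard_eq, mul_comm]
        push_cast
        rfl

end Separation

/-! ### Mean degree under Bernoulli measures -/

section Bernoulli

variable {p : ℕ}

theorem lintegral_letterMeasure (a : stdSimplex ℝ (Fin p)) (D : Fin p → ℕ) :
    ∫⁻ i, (D i : ℝ≥0∞) ∂letterMeasure a = ENNReal.ofReal (∑ i, a.1 i * D i) := by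
  rw [letterMeasure, lintegral_finsetSum_measure,
    ENNReal.ofReal_sum_of_nonneg fun i _ => mul_nonneg (a.2.1 i) (Nat.cast_nonneg _)]
  refine Finset.sum_congr rfl fun i _ => ?_
  rw [lintegral_smul_measure, lintegral_dirac, smul_eq_mul, ENNReal.ofReal_mul (a.2.1 i),
    ENNReal.ofReal_natCast]

theorem lintegral_eval_bernoulliMeasure (a : stdSimplex ℝ (Fin p)) (D : Fin p → ℕ) (j : ℕ) :
    ∫⁻ w, (D (w j) : ℝ≥0∞) ∂(bernoulliMeasure a : Measure (ℕ → Fin p)) =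
      ENNReal.ofReal (∑ i, a.1 i * D i) := by
  rw [← lintegral_letterMeasure]
  exact (measurePreserving_eval_infinitePi (fun _ : ℕ => letterMeasure a) j).lintegral_comp
    (f := fun i => (D i : ℝ≥0∞)) (measurable_of_finite _)

theorem lintegral_prod_bernoulliMeasure (a : stdSimplex ℝ (Fin p)) (D : Fin p → ℕ) (n : ℕ) :
    ∫⁻ w, ((∏ j ∈ Finset.range n, D (w j) : ℕ) : ℝ≥0∞)
      ∂(bernoulliMeasure a : Measure (ℕ → Fin p)) =
      ENNReal.ofReal ((∑ i, a.1 i * D i) ^ n) := by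
  have hind := ProbabilityTheory.iIndepFun_infinitePi (ι := ℕ) (P := fun _ => letterMeasure a)
    (X := fun _ i => (D i : ℝ≥0∞)) (fun _ => measurable_of_finite _)
  have h := ProbabilityTheory.lintegral_prod_eq_prod_lintegral_of_indepFun (Finset.range n)
    (fun (j : ℕ) (w : ℕ → Fin p) => (D (w j) : ℝ≥0∞)) hind
    (fun j => (measurable_of_finite fun i => (D i : ℝ≥0∞)).comp (measurable_pi_apply j))
  simp only [Nat.cast_prod]
  refine h.trans ?_
  rw [ENNReal.ofReal_pow (Finset.sum_nonneg fun i _ => mul_nonneg (a.2.1 i) (Nat.cast_nonneg _))]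
  exact (Finset.prod_congr rfl fun j _ => lintegral_eval_bernoulliMeasure a D j).trans (by simp)

theorem integral_eval_bernoulliMeasure (a : stdSimplex ℝ (Fin p)) (D : Fin p → ℕ) (j : ℕ) :
    ∫ w, (D (w j) : ℝ) ∂(bernoulliMeasure a : Measure (ℕ → Fin p)) = ∑ i, a.1 i * D i := by
  have hm : Measurable fun w : ℕ → Fin p => (D (w j) : ℝ) :=
    (measurable_of_finite fun i => (D i : ℝ)).comp (measurable_pi_apply j)
  rw [integral_eq_lintegral_of_nonneg_ae (Eventually.of_forall fun w => Nat.cast_nonneg _)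
    hm.aestronglyMeasurable]
  simp only [ENNReal.ofReal_natCast]
  rw [lintegral_eval_bernoulliMeasure, ENNReal.toReal_ofReal
    (Finset.sum_nonneg fun i _ => mul_nonneg (a.2.1 i) (Nat.cast_nonneg _))]

theorem one_le_sum_stdSimplex_mul (a : stdSimplex ℝ (Fin p)) {D : Fin p → ℕ}
    (hD : ∀ i, 0 < D i) : 1 ≤ ∑ i, a.1 i * (D i : ℝ) := by
  rw [← a.2.2]
  exact Finset.sum_le_sum fun i _ =>
    le_mul_of_one_le_right (a.2.1 i) (by exact_mod_cast hD i)

theorem sum_stdSimplex_mul_le (a : stdSimplex ℝ (Fin p)) (D : Fin p → ℕ) :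
    ∑ i, a.1 i * (D i : ℝ) ≤ (Finset.univ.sup D : ℕ) := by
  calc ∑ i, a.1 i * (D i : ℝ) ≤ ∑ i, a.1 i * ((Finset.univ.sup D : ℕ) : ℝ) :=
        Finset.sum_le_sum fun i _ => mul_le_mul_of_nonneg_left
          (by exact_mod_cast Finset.le_sup (f := D) (Finset.mem_univ i)) (a.2.1 i)
    _ = _ := by rw [← Finset.sum_mul, a.2.2, one_mul]

theorem sum_barycenter_mul_eq_sup_iff [NeZero p] (D : Fin p → ℕ) :
    ∑ i, (stdSimplex.barycenter : stdSimplex ℝ (Fin p)).1 i * (D i : ℝ) =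
      (Finset.univ.sup D : ℕ) ↔ ∃ k, ∀ i, D i = k := by
  have hp : (p : ℝ) ≠ 0 := Nat.cast_ne_zero.2 (NeZero.ne p)
  have h1 : ∑ i, (stdSimplex.barycenter : stdSimplex ℝ (Fin p)).1 i * (D i : ℝ) =
      (p : ℝ)⁻¹ * ∑ i, (D i : ℝ) := by
    rw [Finset.mul_sum]
    exact Finset.sum_congr rfl fun i _ => by rw [stdSimplex.barycenter_apply, Fintype.card_fin]
  rw [h1, inv_mul_eq_iff_eq_mul₀ hp]
  have h2 : (p : ℝ) * ((Finset.univ.sup D : ℕ) : ℝ) =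
      ∑ _i : Fin p, ((Finset.univ.sup D : ℕ) : ℝ) := by simp
  -- Each degree is at most the maximum, so the sums agree only if every term does.
  rw [h2, Finset.sum_eq_sum_iff_of_le fun i hi => Nat.cast_le.2 (Finset.le_sup (f := D) hi)]
  constructor
  · intro h
    exact ⟨Finset.univ.sup D, fun i => by exact_mod_cast h i (Finset.mem_univ i)⟩
  · rintro ⟨k, hk⟩ i -
    obtain rfl : D = fun _ => k := funext hk
    rw [Finset.sup_const ⟨i, Finset.mem_univ i⟩]

end Bernoulli

/-! ### The entropy formula and its consequences -/

section Entropy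

theorem tendsto_log_mul_pow_div {C S : ℝ} (hC : 0 < C) (hS : 0 < S) :
    Tendsto (fun n : ℕ => ENNReal.log (ENNReal.ofReal (C * S ^ n)) / (n : EReal)) atTop
      (𝓝 (Real.log S : EReal)) := by
  have h : Tendsto (fun n : ℕ => Real.log C / n + Real.log S) atTop (𝓝 (Real.log S)) := by
    simpa using (tendsto_const_div_atTop_nhds_zero_nat (Real.log C)).add_const (Real.log S)
  refine (continuous_coe_real_ereal.continuousAt.tendsto.comp h).congr' ?_
  filter_upwards [eventually_gt_atTop 0] with n hn
  have hn' : (n : ℝ) ≠ 0 := by positivity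
  rw [ENNReal.log_ofReal_of_pos (by positivity), Real.log_mul hC.ne' (by positivity),
    Real.log_pow, Function.comp_apply]
  change _ = ((_ : ℝ) : EReal) / (((n : ℝ)) : EReal)
  rw [← EReal.coe_div, add_div, mul_div_cancel_left₀ _ hn']

variable {M : Type*} [MetricSpace M] [CompactSpace M] [ConnectedSpace M] {p : ℕ} {g : Fin p → M → M}

/-- The relative entropy with respect to a Bernoulli measure is the logarithm of the mean
degree. -/
theorem relEntropy_bernoulliMeasure (hg : ∀ i, IsLocalHomeomorph (g i))
    (hlift : ∀ i y z r, dist (g i y) z < r → ∃ y', g i y' = z ∧ dist y y' < r)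
    (a : stdSimplex ℝ (Fin p)) :
    relEntropy g (bernoulliMeasure a : Measure (ℕ → Fin p)) =
      (Real.log (∑ i, a.1 i * (mapDegree (g i) : ℝ)) : EReal) := by
  have hS : 0 < ∑ i, a.1 i * (mapDegree (g i) : ℝ) :=
    one_pos.trans_le (one_le_sum_stdSimplex_mul a fun i => (hg i).mapDegree_pos)
  apply le_antisymm
  · refine iSup₂_le fun ε hε => ?_
    obtain ⟨N, hN⟩ := exists_sepCard_le_mul_prod hg hlift hε
    -- `N + 1` rather than `N`, so that the constant is visibly positive.
    rw [← (tendsto_log_mul_pow_div (C := N + 1) (by positivity) hS).limsup_eq]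
    refine limsup_le_limsup (Eventually.of_forall fun n => ?_) (by isBoundedDefault)
      (by isBoundedDefault)
    refine EReal.div_le_div_right_of_nonneg (by positivity) (ENNReal.log_le_log ?_)
    rw [ENNReal.ofReal_mul (by positivity),
      ← lintegral_prod_bernoulliMeasure a (fun i => mapDegree (g i)),
      ← lintegral_const_mul' _ _ ENNReal.ofReal_ne_top]
    refine lintegral_mono fun w => (ENat.toENNReal_le.2 (hN w n)).trans ?_
    rw [ENat.toENNReal_coe, Nat.cast_mul]
    gcongr
    rw [← ENNReal.ofReal_natCast]
    exact ENNReal.ofReal_le_ofReal (by linarith)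
  · obtain ⟨ε, hε, h⟩ := exists_prod_le_sepCard hg
    refine le_trans ?_ (le_iSup₂ (f := fun ε (_ : ε ∈ Ioi (0 : ℝ)) =>
      relEntropyAt g (bernoulliMeasure a : Measure (ℕ → Fin p)) ε) ε hε)
    rw [← (tendsto_log_mul_pow_div one_pos hS).limsup_eq]
    refine limsup_le_limsup (Eventually.of_forall fun n => ?_) (by isBoundedDefault)
      (by isBoundedDefault)
    refine EReal.div_le_div_right_of_nonneg (by positivity) (ENNReal.log_le_log ?_)
    rw [one_mul, ← lintegral_prod_bernoulliMeasure a (fun i => mapDegree (g i))]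
    refine lintegral_mono fun w => le_trans ?_ (ENat.toENNReal_le.2 (h w n))
    rw [ENat.toENNReal_coe]

theorem continuous_relEntropy (hg : ∀ i, IsLocalHomeomorph (g i))
    (hlift : ∀ i y z r, dist (g i y) z < r → ∃ y', g i y' = z ∧ dist y y' < r) :
    Continuous fun η : bernoulliMeasures p => relEntropy g (η.1 : Measure (ℕ → Fin p)) := by
  -- The degree of the first letter is continuous on the shift space and its integral is the mean
  -- degree, so weak convergence passes directly to the entropy.
  let f : BoundedContinuousFunction (ℕ → Fin p) ℝ := BoundedContinuousFunction.mkOfCompact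
    ⟨fun w => (mapDegree (g (w 0)) : ℝ),
      (continuous_of_discreteTopology (f := fun i => (mapDegree (g i) : ℝ))).comp
        (continuous_apply 0)⟩
  have hf : ∀ a : stdSimplex ℝ (Fin p), ∫ w, f w ∂(bernoulliMeasure a : Measure (ℕ → Fin p)) =
      ∑ i, a.1 i * (mapDegree (g i) : ℝ) :=
    fun a => integral_eval_bernoulliMeasure a (fun i => mapDegree (g i)) 0
  have hc : Continuous fun η : bernoulliMeasures p => ∫ w, f w ∂(η.1 : Measure (ℕ → Fin p)) :=
    (ProbabilityMeasure.continuous_integral_boundedContinuousFunction f).comp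
      continuous_subtype_val
  refine (continuous_coe_real_ereal.comp (hc.log ?_)).congr ?_
  · rintro ⟨_, a, rfl⟩
    rw [hf]
    exact (one_pos.trans_le
      (one_le_sum_stdSimplex_mul a fun i => (hg i).mapDegree_pos)).ne'
  · rintro ⟨_, a, rfl⟩
    rw [relEntropy_bernoulliMeasure hg hlift, Function.comp_apply, hf]

theorem exists_relEntropy_bernoulliMeasure_eq [NeZero p] (hg : ∀ i, IsLocalHomeomorph (g i))
    (hlift : ∀ i y z r, dist (g i y) z < r → ∃ y', g i y' = z ∧ dist y y' < r) :
    ∃ a : stdSimplex ℝ (Fin p), relEntropy g (bernoulliMeasure a : Measure (ℕ → Fin p)) =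
      ((Real.log ((Finset.univ.sup fun i => mapDegree (g i) : ℕ) : ℝ) : ℝ) : EReal) := by
  obtain ⟨i, -, hi⟩ := Finset.exists_mem_eq_sup Finset.univ Finset.univ_nonempty
    fun i => mapDegree (g i)
  -- All mass goes to a letter of maximal degree.
  refine ⟨⟨Pi.single i 1, single_mem_stdSimplex ℝ i⟩, ?_⟩
  rw [relEntropy_bernoulliMeasure hg hlift, hi]
  simp [Pi.single_apply]

theorem iSup_relEntropy_bernoulliMeasures [NeZero p] (hg : ∀ i, IsLocalHomeomorph (g i))
    (hlift : ∀ i y z r, dist (g i y) z < r → ∃ y', g i y' = z ∧ dist y y' < r) :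
    (⨆ η ∈ bernoulliMeasures p, relEntropy g (η : Measure (ℕ → Fin p))) =
      ((Real.log ((Finset.univ.sup fun i => mapDegree (g i) : ℕ) : ℝ) : ℝ) : EReal) := by
  apply le_antisymm
  · refine iSup₂_le ?_
    rintro _ ⟨a, rfl⟩
    rw [relEntropy_bernoulliMeasure hg hlift, EReal.coe_le_coe_iff]
    exact Real.log_le_log
      (one_pos.trans_le (one_le_sum_stdSimplex_mul a fun i => (hg i).mapDegree_pos))
      (sum_stdSimplex_mul_le a _)
  · obtain ⟨a, ha⟩ := exists_relEntropy_bernoulliMeasure_eq hg hlift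
    rw [← ha]
    exact le_iSup₂ (f := fun (η : ProbabilityMeasure (ℕ → Fin p)) (_ : η ∈ bernoulliMeasures p) =>
      relEntropy g (η : Measure (ℕ → Fin p))) (bernoulliMeasure a) (mem_range_self a)

end Entropy

theorem mainTheorem5 {d : ℕ} {M : Type*} [MetricSpace M] [CompactSpace M] [ConnectedSpace M]
    [ChartedSpace (EuclideanSpace ℝ (Fin d)) M] [IsManifold (𝓡 d) ∞ M]
    [RiemannianBundle (fun x : M => TangentSpace (𝓡 d) x)]
    [IsContMDiffRiemannianBundle (𝓡 d) ∞ (EuclideanSpace ℝ (Fin d))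
      (fun x : M => TangentSpace (𝓡 d) x)]
    [IsRiemannianManifold (𝓡 d) M]
    {p : ℕ} [NeZero p] (g : Fin p → M → M) (hg : ∀ i, IsC2Expanding (d := d) (g i)) :
    -- the degrees are well defined
    (∀ i, ∀ x : M, (g i ⁻¹' {x}).encard = mapDegree (g i)) ∧
    -- the entropy map is continuous on the space of Bernoulli measures
    Continuous (fun η : bernoulliMeasures p => relEntropy g (η.1 : Measure (ℕ → Fin p))) ∧
    -- the supremum of the entropy is attained
    (∃ η₀ ∈ bernoulliMeasures p,
      (⨆ η ∈ bernoulliMeasures p, relEntropy g (η : Measure (ℕ → Fin p))) =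
        relEntropy g (η₀ : Measure (ℕ → Fin p))) ∧
    -- its value
    ((⨆ η ∈ bernoulliMeasures p, relEntropy g (η : Measure (ℕ → Fin p))) =
      ((Real.log ((Finset.univ.sup fun i => mapDegree (g i) : ℕ) : ℝ) : ℝ) : EReal)) ∧
    -- the symmetric random walk is maximizing if and only if all degrees coincide
    ((⨆ η ∈ bernoulliMeasures p, relEntropy g (η : Measure (ℕ → Fin p))) =
        relEntropy g (symmetricBernoulli p : Measure (ℕ → Fin p)) ↔
      ∃ k : ℕ, ∀ i, mapDegree (g i) = k) := by
  have hloc : ∀ i, IsLocalHomeomorph (g i) := fun i => (hg i).isLocalHomeomorph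
  have hlift : ∀ i y z r, dist (g i y) z < r → ∃ y', g i y' = z ∧ dist y y' < r :=
    fun i y z r h => (hg i).exists_preimage_dist_lt h
  have hsup := iSup_relEntropy_bernoulliMeasures hloc hlift
  refine ⟨fun i => (hloc i).encard_fiber, continuous_relEntropy hloc hlift, ?_, hsup, ?_⟩
  · obtain ⟨a, ha⟩ := exists_relEntropy_bernoulliMeasure_eq hloc hlift
    exact ⟨bernoulliMeasure a, mem_range_self a, hsup.trans ha.symm⟩
  · have hb := one_le_sum_stdSimplex_mul (stdSimplex.barycenter : stdSimplex ℝ (Fin p))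
      fun i => (hloc i).mapDegree_pos
    rw [hsup, symmetricBernoulli, relEntropy_bernoulliMeasure hloc hlift, EReal.coe_eq_coe_iff,
      eq_comm, ← sum_barycenter_mul_eq_sup_iff]
    refine ⟨fun h => Real.log_injOn_pos (one_pos.trans_le hb) ?_ h, congrArg Real.log⟩
    exact one_pos.trans_le (hb.trans (sum_stdSimplex_mul_le _ _))
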